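/- **Setting.** Let $\Sigma$ be a finite alphabet, $n\ge 1$, $Z$ a set (of explicit inputs), $f$ a partial function from $Z\times\Sigma^n$ to $\{0,1\}$ and $V\subseteq\Sigma^n$. A *query algorithm* $M$ gets $z\in Z$ explicitly, has query access to $x\in\Sigma^n$, tosses coins, queries coordinates of $x$ adaptively and outputs an element $M^x(z)\in\{0,1,\bot\}$; its query complexity is the maximal number of queries over all $z$, $x$ and coin tosses. A *sample-based algorithm* $N$ selects a random set $Q\subseteq[n]$ by including each coordinate independently with the same probability $p$ (independent of $z$); if $|Q|$ exceeds a cap $k$ it queries nothing, otherwise it queries exactly the coordinates in $Q$; its output $N^x(z)\in\{0,1,\bot\}$ is then chosen (possibly at random) depending only on $z$, $Q$ and the queried symbols. We say that $N$ has sample complexity at most $s$ if $k\le s$ and $pn\le s$. An algorithm $A$ of either kind is a *relaxed* algorithm for $f$ with valid input set $V$ (and error rate $1/3$) if for all $(z,x)$ in the domain of $f$: $\Pr[A^x(z)=f(z,x)]\ge 2/3$ if $x\in V$, and $\Pr[A^x(z)\in\{f(z,x),\bot\}]\ge 2/3$ if $x\notin V$. It is *$(\rho_0,\rho_1)$-robust*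 if for all $b\in\{0,1\}$, all $(z,x)$ with $f(z,x)=b$ and all $w\in\Sigma^n$ that differ from $x$ in at most $\rho_b n$ coordinates, $\Pr[A^w(z)\in\{b,\bot\}]\ge 2/3$. **Theorem.** There are absolute constants $C,c>0$ such that for every integer $\ell\ge 1$ and all $\rho_0,\rho_1>0$ there is $n_0=n_0(\ell,\rho_0,\rho_1)$ such that the following holds for all $n\ge n_0$, every set $Z$, every finite alphabet $\Sigma$ with $|\Sigma|\le n^{c/(\ell^3\log^3(\ell+1))}$ (in particular for every fixed finite alphabet, when $n$ is large enough), every partial function $f$ from $Z\times\Sigma^n$ to $\{0,1\}$ and every $V\subseteq\Sigma^n$. If there is a $(\rho_0,\rho_1)$-robust relaxed algorithm for $f$ with valid input set $V$ that makes at most $\ell$ queries, then there is a sample-based relaxed algorithm for $f$ with the same valid input set $V$ and sample complexity at most $$n^{\,1-\frac{1}{C\,\ell^2\log^2(\ell+1)}}.$$ -/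

import Mathlib

universe u v

open scoped ENNReal NNReal

noncomputable section

namespace RobustLocal

/-- A deterministic adaptive query algorithm on strings of length `n` over the alphabet `α`:
inner nodes query a coordinate and branch on the symbol read there, leaves carry the output
`0`, `1` (as `false`, `true`) or the abort symbol `⊥`. -/
inductive DecisionTree (n : ℕ) (α : Type v) : Type v
  | leaf (out : WithBot Bool) : DecisionTree n α
  | query (i : Fin n) (next : α → DecisionTree n α) : DecisionTree n α

/-- The output of a decision tree on the string `x`. -/
def DecisionTree.eval {n : ℕ} {α : Type v} (x : Fin n → α) : DecisionTree n α → WithBot Bool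
  | .leaf out => out
  | .query i next => (next (x i)).eval x

/-- The number of queries that a decision tree makes to the string `x`. -/
def DecisionTree.numQueries {n : ℕ} {α : Type v} (x : Fin n → α) : DecisionTree n α → ℕ
  | .leaf _ => 0
  | .query i next => (next (x i)).numQueries x + 1

/-- A randomised (adaptive) query algorithm with explicit input in `Z`, query access to a string
of length `n` over `α`, and outputs in `{0, 1, ⊥}`: given `z`, it tosses coins, which select
a decision tree, and then runs that tree. -/
structure QueryAlgorithm (Z : Type u) (n : ℕ) (α : Type v) where
  tree : Z → PMF (DecisionTree n α)

/-- The distribution of the output `M^x(z)`, over the coin tosses of `M`. -/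
def QueryAlgorithm.run {Z : Type u} {n : ℕ} {α : Type v} (M : QueryAlgorithm Z n α)
    (z : Z) (x : Fin n → α) : PMF (WithBot Bool) :=
  (M.tree z).map (DecisionTree.eval x)

/-- `M` makes at most `q` queries, for every explicit input, every string and all coin tosses. -/
def QueryAlgorithm.QueryComplexityAtMost {Z : Type u} {n : ℕ} {α : Type v}
    (M : QueryAlgorithm Z n α) (q : ℕ) : Prop :=
  ∀ z, ∀ T ∈ (M.tree z).support, ∀ x, T.numQueries x ≤ q

/-- The random subset of `[n]` that contains each coordinate independently with probability `p`:
it equals `Q` with probability `p ^ |Q| * (1 - p) ^ (n - |Q|)`. -/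
def bernoulliSubset (n : ℕ) (p : ℝ≥0) (hp : p ≤ 1) : PMF (Finset (Fin n)) :=
  PMF.ofFintype (fun Q => ((p ^ Q.card * (1 - p) ^ (n - Q.card) : ℝ≥0) : ℝ≥0∞)) (by
    have h := Finset.sum_pow_mul_eq_add_pow p (1 - p) (Finset.univ : Finset (Fin n))
    rw [Finset.powerset_univ, Finset.card_univ, Fintype.card_fin, add_tsub_cancel_of_le hp,
      one_pow] at h
    rw [← ENNReal.ofNNReal_finsetSum, h, ENNReal.coe_one])

/-- The restriction of `x` to the coordinates in `S`, with `none` elsewhere. -/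
def restriction {n : ℕ} {α : Type v} (x : Fin n → α) (S : Finset (Fin n)) : Fin n → Option α :=
  fun i => if i ∈ S then some (x i) else none

/-- A sample-based algorithm. It selects each coordinate independently with probability `p`,
where `p` does not depend on the explicit input. If more than `cap` coordinates are selected,
nothing is queried; otherwise exactly the selected coordinates are queried. The output
distribution is determined by the explicit input, the selected set and the queried symbols. -/
structure SampleAlgorithm (Z : Type u) (n : ℕ) (α : Type v) where
  p : ℝ≥0
  p_le_one : p ≤ 1
  cap : ℕ
  output : Z → Finset (Fin n) → (Fin n → Option α) → PMF (WithBot Bool)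

/-- The distribution of the output `N^x(z)`, over the sample and the inner randomness of `N`. -/
def SampleAlgorithm.run {Z : Type u} {n : ℕ} {α : Type v} (N : SampleAlgorithm Z n α)
    (z : Z) (x : Fin n → α) : PMF (WithBot Bool) :=
  (bernoulliSubset n N.p N.p_le_one).bind fun Q =>
    N.output z Q (restriction x (if Q.card ≤ N.cap then Q else ∅))

/-- Sample complexity at most `s`: in every execution at most `s` coordinates are queried, and
moreover the expected number `p * n` of selected coordinates is at most `s`. -/
def SampleAlgorithm.SampleComplexityAtMost {Z : Type u} {n : ℕ} {α : Type v}
    (N : SampleAlgorithm Z n α) (s : ℝ) : Prop :=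
  (N.cap : ℝ) ≤ s ∧ (N.p : ℝ) * n ≤ s

/-- The probability that an output with distribution `P` lies in `S`. -/
def prob (P : PMF (WithBot Bool)) (S : Set (WithBot Bool)) : ℝ :=
  (P.toOuterMeasure S).toReal

/-- An algorithm, given through its output distributions `run`, computes the partial function `f`
in the relaxed sense with error rate `σ` and valid input set `V`: on every input `(z, x)` in the
domain of `f` it outputs `f (z, x)` with probability at least `1 - σ` if `x ∈ V`, and an element
of `{f (z, x), ⊥}` with probability at least `1 - σ` if `x ∉ V`. -/
def RelaxedComputes {Z : Type u} {n : ℕ} {α : Type v}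
    (run : Z → (Fin n → α) → PMF (WithBot Bool)) (f : Z × (Fin n → α) →. Bool)
    (V : Set (Fin n → α)) (σ : ℝ) : Prop :=
  ∀ z x, ∀ b ∈ f (z, x),
    (x ∈ V → 1 - σ ≤ prob (run z x) {(b : WithBot Bool)}) ∧
    (x ∉ V → 1 - σ ≤ prob (run z x) {(b : WithBot Bool), ⊥})

/-- `(ρ₀, ρ₁)`-robustness with error rate `σ`, in the relaxed sense: if `f (z, x) = b` then on
every `w` at relative Hamming distance at most `ρ_b` from `x` the output is in `{b, ⊥}` with
probability at least `1 - σ`. -/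
def RelaxedRobust {Z : Type u} {n : ℕ} {α : Type v} [DecidableEq α]
    (run : Z → (Fin n → α) → PMF (WithBot Bool)) (f : Z × (Fin n → α) →. Bool)
    (ρ₀ ρ₁ σ : ℝ) : Prop :=
  ∀ z x, ∀ b ∈ f (z, x), ∀ w : Fin n → α,
    (hammingDist x w : ℝ) ≤ (if b then ρ₁ else ρ₀) * n →
      1 - σ ≤ prob (run z w) {(b : WithBot Bool), ⊥}

end RobustLocal

end

/-! A randomised algorithm is a distribution over deterministic trees, and a sample containing all
queries of a tree simulates that tree. Weighting each tree by the inverse probability that its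
queries are sampled gives an unbiased estimate of the output distribution. It concentrates, by
bounded differences, when no coordinate is queried too often.

Popular coordinates spoil this, so they form a kernel `K` whose contents are guessed exhaustively.
Degrees sum to at most `N = (|α| + 1) ^ ℓ`, so `K` is small; by robustness the wrong value keeps
probability at most 1/3 under every guess. The obstacle is the union bound over `|α| ^ |K|` guesses:
at threshold `r ^ (-j)` the kernel may have `N r ^ j` elements, while degrees just below the
threshold give a failure exponent of the same order in `r`. Discarding trees that query the band of
degrees in `[r ^ (-(j+1)), r ^ (-j))` gains a factor `r` in the exponent, which pays for `N |α|` and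
for `p ^ (2ℓ)`.

The bands are disjoint, so `ℓ` queries meet at most `ℓ` of the `12ℓ` bands, and for each `x` some
level discards mass at most 1/12 (`exists_band_rarely_queried`). The sampler tries all levels:
discarding never helps the wrong value (`bernoulliMean_supports_le`), and one good level suffices
for the right one (`bernoulliMean_not_supports_le`). The threshold is 11/24 = 1/3 + 1/8 = 2/3 - 1/12
- 1/8. -/

namespace RobustLocal

/-! ### Random subsets and the bounded differences inequality. -/

section BernoulliMean

variable {ι : Type*}

/-- The mean of `g` over the random subset of `s` that contains each element independently with
probability `p`. -/
noncomputable def bernoulliMean (p : ℝ) (s : Finset ι) (g : Finset ι → ℝ) : ℝ :=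
  ∑ Q ∈ s.powerset, p ^ Q.card * (1 - p) ^ (s.card - Q.card) * g Q

lemma bernoulliMean_mono {p : ℝ} (hp0 : 0 ≤ p) (hp1 : p ≤ 1) {s : Finset ι}
    {g h : Finset ι → ℝ} (hgh : ∀ Q ⊆ s, g Q ≤ h Q) :
    bernoulliMean p s g ≤ bernoulliMean p s h := by
  have : 0 ≤ 1 - p := by linarith
  exact Finset.sum_le_sum fun Q hQ =>
    mul_le_mul_of_nonneg_left (hgh Q (Finset.mem_powerset.1 hQ)) (by positivity)

lemma bernoulliMean_const_mul (p : ℝ) (s : Finset ι) (c : ℝ) (g : Finset ι → ℝ) :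
    bernoulliMean p s (fun Q => c * g Q) = c * bernoulliMean p s g := by
  unfold bernoulliMean
  rw [Finset.mul_sum]
  exact Finset.sum_congr rfl fun Q _ => by ring

lemma bernoulliMean_sum {κ : Type*} (p : ℝ) (s : Finset ι) (t : Finset κ)
    (g : κ → Finset ι → ℝ) :
    bernoulliMean p s (fun Q => ∑ k ∈ t, g k Q) = ∑ k ∈ t, bernoulliMean p s (g k) := by
  unfold bernoulliMean
  rw [Finset.sum_comm]
  exact Finset.sum_congr rfl fun Q _ => by rw [Finset.mul_sum]

lemma bernoulliMean_add (p : ℝ) (s : Finset ι) (g h : Finset ι → ℝ) :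
    bernoulliMean p s (fun Q => g Q + h Q) = bernoulliMean p s g + bernoulliMean p s h := by
  unfold bernoulliMean
  rw [← Finset.sum_add_distrib]
  exact Finset.sum_congr rfl fun Q _ => by ring

variable [DecidableEq ι]

lemma bernoulliMean_insert (p : ℝ) {s : Finset ι} {a : ι} (ha : a ∉ s) (g : Finset ι → ℝ) :
    bernoulliMean p (insert a s) g =
      bernoulliMean p s (fun Q => (1 - p) * g Q + p * g (insert a Q)) := by
  unfold bernoulliMean
  rw [Finset.sum_powerset_insert ha, ← Finset.sum_add_distrib]
  refine Finset.sum_congr rfl fun Q hQ => ?_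
  have hQs := Finset.mem_powerset.1 hQ
  have haQ : a ∉ Q := fun h => ha (hQs h)
  rw [Finset.card_insert_of_notMem ha, Finset.card_insert_of_notMem haQ,
    Nat.add_sub_add_right, Nat.sub_add_comm (Finset.card_le_card hQs)]
  ring

/-- Expand a product over `s` whose factors are `p + 0` on `A` and `p + (1 - p)` elsewhere: the
zeros kill exactly the sets `Q` that miss part of `A`. -/
lemma bernoulliMean_indicator_subset (p : ℝ) {s A : Finset ι} (hA : A ⊆ s) :
    bernoulliMean p s (fun Q => if A ⊆ Q then 1 else 0) = p ^ A.card := by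
  have h := Finset.prod_add (fun _ => p) (fun i => if i ∈ A then 0 else 1 - p) s
  have h1 : ∏ i ∈ s, (p + if i ∈ A then 0 else 1 - p) = p ^ A.card := by
    rw [← Finset.prod_subset hA (f := fun i => p + if i ∈ A then 0 else 1 - p)]
    · rw [Finset.prod_congr rfl (g := fun _ => p) (fun i hi => by simp [hi]),
        Finset.prod_const]
    · intro i _ hi
      simp [hi]
  rw [← h1, h]
  refine Finset.sum_congr rfl fun Q hQ => ?_
  have hQs := Finset.mem_powerset.1 hQ
  rw [Finset.prod_const, mul_assoc]
  congr 1
  beta_reduce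
  split_ifs with hAQ
  · rw [Finset.prod_congr rfl (g := fun _ => 1 - p), Finset.prod_const,
      Finset.card_sdiff_of_subset hQs, mul_one]
    intro i hi
    rw [if_neg fun hiA => (Finset.mem_sdiff.1 hi).2 (hAQ hiA)]
  · obtain ⟨i, hiA, hiQ⟩ := Finset.not_subset.1 hAQ
    rw [mul_zero]
    exact (Finset.prod_eq_zero (Finset.mem_sdiff.2 ⟨hA hiA, hiQ⟩) (by simp [hiA])).symm

lemma bernoulliMean_one (p : ℝ) (s : Finset ι) : bernoulliMean p s (fun _ => 1) = 1 := by
  simpa using bernoulliMean_indicator_subset p (Finset.empty_subset s)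

lemma bernoulliMean_card (p : ℝ) (s : Finset ι) :
    bernoulliMean p s (fun Q => (Q.card : ℝ)) = p * s.card := by
  have h : bernoulliMean p s (fun Q => (Q.card : ℝ)) =
      bernoulliMean p s (fun Q => ∑ i ∈ s, if {i} ⊆ Q then 1 else 0) := by
    refine Finset.sum_congr rfl fun Q hQ => ?_
    congr 1
    simp only [Finset.singleton_subset_iff]
    rw [Finset.sum_boole, Finset.filter_mem_eq_inter,
      Finset.inter_eq_right.2 (Finset.mem_powerset.1 hQ)]
  rw [h, bernoulliMean_sum,
    Finset.sum_congr rfl fun i hi =>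
      bernoulliMean_indicator_subset p (Finset.singleton_subset_iff.2 hi)]
  simp [mul_comm]

/-- Hoeffding's lemma for a two-point distribution, up to the constant. -/
lemma two_point_exp_le {p : ℝ} (hp0 : 0 ≤ p) (hp1 : p ≤ 1) (a b : ℝ) :
    (1 - p) * Real.exp a + p * Real.exp b ≤
      Real.exp ((1 - p) * a + p * b + (a - b) ^ 2 / 2) := by
  set m := (1 - p) * a + p * b with hm
  have hp1' : 0 ≤ 1 - p := by linarith
  -- Symmetrisation: by Jensen, `exp (-m)` is at most the exponential moment of minus an independent
  -- copy. The product of the two moments belongs to a symmetric difference, hence is a convex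
  -- combination of `1` and `cosh (a - b)`.
  have hconv : Real.exp (-m) ≤ (1 - p) * Real.exp (-a) + p * Real.exp (-b) := by
    have := convexOn_exp.2 (Set.mem_univ (-a)) (Set.mem_univ (-b)) hp1' hp0 (by ring)
    simp only [smul_eq_mul] at this
    rwa [show (1 - p) * -a + p * -b = -m by rw [hm]; ring] at this
  have hcosh := Real.cosh_le_exp_half_sq (a - b)
  have hone := Real.one_le_cosh (a - b)
  have hprod : ((1 - p) * Real.exp a + p * Real.exp b) *
      ((1 - p) * Real.exp (-a) + p * Real.exp (-b)) ≤ Real.exp ((a - b) ^ 2 / 2) := by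
    have e1 : Real.exp a * Real.exp (-a) = 1 := by rw [← Real.exp_add]; simp
    have e2 : Real.exp b * Real.exp (-b) = 1 := by rw [← Real.exp_add]; simp
    have e3 : Real.exp a * Real.exp (-b) + Real.exp b * Real.exp (-a) =
        2 * Real.cosh (a - b) := by
      rw [← Real.exp_add, ← Real.exp_add, Real.cosh_eq, neg_sub, sub_eq_add_neg, sub_eq_add_neg]
      ring
    calc _ = (1 - p) ^ 2 * (Real.exp a * Real.exp (-a)) + p ^ 2 * (Real.exp b * Real.exp (-b)) +
          (1 - p) * p * (Real.exp a * Real.exp (-b) + Real.exp b * Real.exp (-a)) := by ring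
      _ = (1 - p) ^ 2 + p ^ 2 + 2 * ((1 - p) * p) * Real.cosh (a - b) := by
          rw [e1, e2, e3]; ring
      _ ≤ Real.cosh (a - b) := by nlinarith [mul_nonneg hp0 hp1', sq_nonneg p]
      _ ≤ _ := hcosh
  rw [Real.exp_add]
  have hpos : 0 ≤ (1 - p) * Real.exp a + p * Real.exp b := by positivity
  have h := (mul_le_mul_of_nonneg_left hconv hpos).trans hprod
  calc _ = ((1 - p) * Real.exp a + p * Real.exp b) * Real.exp (-m) * Real.exp m := by
        rw [mul_assoc, ← Real.exp_add]; simp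
    _ ≤ Real.exp ((a - b) ^ 2 / 2) * Real.exp m := by gcongr
    _ = _ := mul_comm _ _

/-- The exponential moment bound behind the bounded differences inequality. -/
lemma bernoulliMean_exp_le {p : ℝ} (hp0 : 0 ≤ p) (hp1 : p ≤ 1) (c : ι → ℝ) (s : Finset ι) :
    ∀ g : Finset ι → ℝ, (∀ i ∈ s, ∀ Q ⊆ s, |g (insert i Q) - g Q| ≤ c i) →
      bernoulliMean p s (fun Q => Real.exp (g Q)) ≤
        Real.exp (bernoulliMean p s g + ∑ i ∈ s, c i ^ 2 / 2) := by
  have hp1' : 0 ≤ 1 - p := by linarith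
  induction s using Finset.induction_on with
  | empty => intro g _; simp [bernoulliMean]
  | insert a s ha ih =>
    intro g hg
    rw [bernoulliMean_insert p ha, bernoulliMean_insert p ha, Finset.sum_insert ha]
    -- Averaging out `a` preserves the difference bounds for the other coordinates, so the induction
    -- applies to `h`.
    set h : Finset ι → ℝ := fun Q => (1 - p) * g Q + p * g (insert a Q) with hh
    have hstep : bernoulliMean p s
        (fun Q => (1 - p) * Real.exp (g Q) + p * Real.exp (g (insert a Q))) ≤
        bernoulliMean p s (fun Q => Real.exp (c a ^ 2 / 2) * Real.exp (h Q)) := by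
      refine bernoulliMean_mono hp0 hp1 fun Q hQ => (two_point_exp_le hp0 hp1 _ _).trans ?_
      rw [← Real.exp_add, Real.exp_le_exp]
      have := hg a (Finset.mem_insert_self a s) Q (hQ.trans (Finset.subset_insert a s))
      have : (g Q - g (insert a Q)) ^ 2 ≤ c a ^ 2 := by
        rw [← sq_abs, abs_sub_comm]
        gcongr
      simp only [hh]
      linarith
    refine hstep.trans ?_
    rw [bernoulliMean_const_mul]
    have := ih h fun i hi Q hQ => by
      have h1 := hg i (Finset.mem_insert_of_mem hi) Q (hQ.trans (Finset.subset_insert a s))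
      have h2 := hg i (Finset.mem_insert_of_mem hi) (insert a Q) (Finset.insert_subset_insert a hQ)
      rw [Finset.insert_comm] at h2
      have e : h (insert i Q) - h Q = (1 - p) * (g (insert i Q) - g Q) +
          p * (g (insert a (insert i Q)) - g (insert a Q)) := by simp only [hh]; ring
      rw [e]
      refine (abs_add_le _ _).trans ?_
      rw [abs_mul, abs_mul, abs_of_nonneg hp0, abs_of_nonneg hp1']
      nlinarith
    refine (mul_le_mul_of_nonneg_left this (Real.exp_pos _).le).trans_eq ?_
    rw [← Real.exp_add]
    congr 1
    ring

open Classical in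
/-- The bounded differences inequality for random subsets. -/
lemma bernoulliMean_tail_le {p : ℝ} (hp0 : 0 ≤ p) (hp1 : p ≤ 1) (c : ι → ℝ) (s : Finset ι)
    (g : Finset ι → ℝ) (hg : ∀ i ∈ s, ∀ Q ⊆ s, |g (insert i Q) - g Q| ≤ c i)
    {m ε W : ℝ} (hm : bernoulliMean p s g ≤ m) (hε : 0 ≤ ε) (hW : 0 < W)
    (hc : ∑ i ∈ s, c i ^ 2 ≤ W) :
    bernoulliMean p s (fun Q => if m + ε ≤ g Q then 1 else 0) ≤
      Real.exp (-(ε ^ 2 / (2 * W))) := by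
  -- This minimises the Chernoff exponent `t ^ 2 * W / 2 - t * ε`.
  set t := ε / W with ht
  have ht0 : 0 ≤ t := by positivity
  have h1 : bernoulliMean p s (fun Q => if m + ε ≤ g Q then 1 else 0) ≤
      bernoulliMean p s (fun Q => Real.exp (-(t * (m + ε))) * Real.exp (t * g Q)) := by
    refine bernoulliMean_mono hp0 hp1 fun Q _ => ?_
    rw [← Real.exp_add]
    split_ifs with h
    · refine Real.one_le_exp ?_
      have := mul_le_mul_of_nonneg_left h ht0
      linarith
    · exact (Real.exp_pos _).le
  have h2 := bernoulliMean_exp_le hp0 hp1 (fun i => t * c i) s (fun Q => t * g Q)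
    fun i hi Q hQ => by
      rw [← mul_sub, abs_mul, abs_of_nonneg ht0]
      exact mul_le_mul_of_nonneg_left (hg i hi Q hQ) ht0
  rw [bernoulliMean_const_mul] at h1 h2
  refine h1.trans ((mul_le_mul_of_nonneg_left h2 (Real.exp_pos _).le).trans ?_)
  rw [← Real.exp_add, Real.exp_le_exp]
  have h3 : ∑ i ∈ s, (t * c i) ^ 2 / 2 = t ^ 2 / 2 * ∑ i ∈ s, c i ^ 2 := by
    rw [Finset.mul_sum]
    exact Finset.sum_congr rfl fun i _ => by ring
  rw [h3]
  have h4 := mul_le_mul_of_nonneg_left hm ht0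
  have h5 := mul_le_mul_of_nonneg_left hc (by positivity : 0 ≤ t ^ 2 / 2)
  have h6 : t ^ 2 / 2 * W - t * ε = -(ε ^ 2 / (2 * W)) := by
    rw [ht]; field_simp; ring
  linarith

/-- Markov's inequality for the size of a random subset. -/
lemma bernoulliMean_lt_card_le {p : ℝ} (hp0 : 0 ≤ p) (hp1 : p ≤ 1) (s : Finset ι) {k : ℕ} {t : ℝ}
    (ht : 0 < t) (hk : t ≤ k + 1) :
    bernoulliMean p s (fun Q => if k < Q.card then 1 else 0) ≤ p * s.card / t := by
  have h : bernoulliMean p s (fun Q => if k < Q.card then 1 else 0) ≤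
      bernoulliMean p s (fun Q => t⁻¹ * (Q.card : ℝ)) := by
    refine bernoulliMean_mono hp0 hp1 fun Q _ => ?_
    split_ifs with hQ
    · have : (k : ℝ) + 1 ≤ Q.card := by exact_mod_cast hQ
      rw [← div_eq_inv_mul, one_le_div ht]
      linarith
    · positivity
  refine h.trans_eq ?_
  rw [bernoulliMean_const_mul, bernoulliMean_card]
  ring

end BernoulliMean

/-! ### Coordinates read by decision trees. -/

section DecisionTree

variable {n : ℕ} {α : Type v}

/-- The set of coordinates that a decision tree queries on the string `x`. -/
def DecisionTree.queried (x : Fin n → α) : DecisionTree n α → Finset (Fin n)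
  | .leaf _ => ∅
  | .query i next => insert i ((next (x i)).queried x)

lemma DecisionTree.card_queried_le (x : Fin n → α) (T : DecisionTree n α) :
    (T.queried x).card ≤ T.numQueries x := by
  induction T with
  | leaf out => simp [queried]
  | query i next ih =>
    exact (Finset.card_insert_le _ _).trans (Nat.add_le_add_right (ih (x i)) 1)

lemma DecisionTree.queried_eval_congr {x y : Fin n → α} (T : DecisionTree n α)
    (h : ∀ i ∈ T.queried x, x i = y i) :
    T.queried y = T.queried x ∧ T.eval y = T.eval x := by
  induction T with
  | leaf out => exact ⟨rfl, rfl⟩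
  | query i next ih =>
    have hi : x i = y i := h i (Finset.mem_insert_self _ _)
    have := ih (x i) fun k hk => h k (Finset.mem_insert_of_mem hk)
    simp only [queried, eval, ← hi]
    exact ⟨by rw [this.1], this.2⟩

/-- A root and `|α|` subtrees give the recursion `N' = |α| N + 1`. Only strings in `A`, those
reaching the current node, are constrained: a branch that contradicts an earlier reading may be
arbitrarily deep. -/
lemma DecisionTree.card_biUnion_queried_le [Fintype α] [DecidableEq α] (T : DecisionTree n α) :
    ∀ (ℓ : ℕ) (A : Finset (Fin n → α)), (∀ x ∈ A, T.numQueries x ≤ ℓ) →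
      (A.biUnion fun x => T.queried x).card ≤ (Fintype.card α + 1) ^ ℓ := by
  induction T with
  | leaf out =>
    intro ℓ A _
    have : (A.biUnion fun x => (DecisionTree.leaf out : DecisionTree n α).queried x) = ∅ := by
      ext; simp [queried]
    rw [this]
    simp
  | query i next ih =>
    intro ℓ A hA
    rcases A.eq_empty_or_nonempty with rfl | ⟨x₀, hx₀⟩
    · simp
    obtain _ | ℓ := ℓ
    · exact absurd (hA x₀ hx₀) (by simp [numQueries])
    have hsub : (A.biUnion fun x => (DecisionTree.query i next).queried x) ⊆
        insert i (Finset.univ.biUnion fun a =>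
          (A.filter fun x => x i = a).biUnion fun x => (next a).queried x) := by
      intro k hk
      obtain ⟨x, hx, hk⟩ := Finset.mem_biUnion.1 hk
      rcases Finset.mem_insert.1 hk with rfl | hk
      · exact Finset.mem_insert_self _ _
      · exact Finset.mem_insert_of_mem (Finset.mem_biUnion.2 ⟨x i, Finset.mem_univ _,
          Finset.mem_biUnion.2 ⟨x, by simp [hx], hk⟩⟩)
    have hbranch (a : α) : ((A.filter fun x => x i = a).biUnion fun x =>
        (next a).queried x).card ≤ (Fintype.card α + 1) ^ ℓ := by
      refine ih a ℓ _ fun x hx => ?_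
      obtain ⟨hxA, rfl⟩ := Finset.mem_filter.1 hx
      exact Nat.le_of_succ_le_succ (hA x hxA)
    calc _ ≤ _ := Finset.card_le_card hsub
      _ ≤ Fintype.card α * (Fintype.card α + 1) ^ ℓ + 1 := by
        refine (Finset.card_insert_le _ _).trans (Nat.add_le_add_right ?_ 1)
        exact Finset.card_biUnion_le_card_mul _ _ _ fun a _ => hbranch a
      _ ≤ _ := by
        rw [pow_succ, mul_add, mul_one, mul_comm]
        exact Nat.add_le_add_left (Nat.one_le_pow _ _ (Nat.succ_pos _)) _

end DecisionTree

/-- What the run of a deterministic `ℓ`-query algorithm on all possible strings looks like from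
the outside: the set of coordinates queried and the output, as functions of the string. -/
structure LocalView (n : ℕ) (α : Type v) (ℓ N : ℕ) where
  queried : (Fin n → α) → Finset (Fin n)
  out : (Fin n → α) → WithBot Bool
  congr : ∀ x y, (∀ i ∈ queried x, x i = y i) → queried y = queried x ∧ out y = out x
  card_queried_le : ∀ x, (queried x).card ≤ ℓ
  card_le_of_forall : ∀ S : Finset (Fin n), (∀ i ∈ S, ∃ x, i ∈ queried x) → S.card ≤ N

/-! ### Finite views of query algorithms. -/

section LocalView

variable {n : ℕ} {α : Type v} {ℓ N : ℕ}

-- Unlike trees, whose unreachable branches are unbounded, views form a finite type, so means over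
-- the coins become finite sums.
instance [Finite α] : Finite (LocalView n α ℓ N) :=
  Finite.of_injective
    (β := ((Fin n → α) → Finset (Fin n)) × ((Fin n → α) → Option Bool))
    (fun F => (F.queried, F.out)) fun F G h => by
      cases F; cases G
      cases h
      rfl

noncomputable instance [Finite α] : Fintype (LocalView n α ℓ N) := Fintype.ofFinite _

instance : Inhabited (LocalView n α ℓ N) :=
  ⟨⟨fun _ => ∅, fun _ => ⊥, fun _ _ _ => ⟨rfl, rfl⟩, by simp, fun S hS => by
    rcases S.eq_empty_or_nonempty with rfl | ⟨i, hi⟩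
    · simp
    · simpa using hS i hi⟩⟩

/-- The view of a decision tree that makes at most `ℓ` queries. -/
def DecisionTree.toLocalView [Fintype α] [DecidableEq α] (T : DecisionTree n α)
    (hT : ∀ x, T.numQueries x ≤ ℓ) : LocalView n α ℓ ((Fintype.card α + 1) ^ ℓ) where
  queried x := T.queried x
  out x := T.eval x
  congr _ _ := T.queried_eval_congr
  card_queried_le x := (T.card_queried_le x).trans (hT x)
  card_le_of_forall S hS := by
    refine (Finset.card_le_card fun i hi => ?_).trans
      (T.card_biUnion_queried_le ℓ Finset.univ fun x _ => hT x)
    obtain ⟨x, hx⟩ := hS i hi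
    exact Finset.mem_biUnion.2 ⟨x, Finset.mem_univ _, hx⟩

open Classical in
/-- The distribution of the view of a randomised query algorithm. -/
noncomputable def QueryAlgorithm.view {Z : Type u} [Fintype α] [DecidableEq α]
    (M : QueryAlgorithm Z n α) (ℓ : ℕ) (z : Z) :
    PMF (LocalView n α ℓ ((Fintype.card α + 1) ^ ℓ)) :=
  (M.tree z).map fun T => if hT : ∀ x, T.numQueries x ≤ ℓ then T.toLocalView hT else default

/-- Only trees of probability zero are replaced by the default view. -/
lemma QueryAlgorithm.run_eq_map_view {Z : Type u} [Fintype α] [DecidableEq α]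
    {M : QueryAlgorithm Z n α} (hM : M.QueryComplexityAtMost ℓ) (z : Z) (x : Fin n → α) :
    M.run z x = (M.view ℓ z).map fun F => F.out x := by
  rw [QueryAlgorithm.run, QueryAlgorithm.view, PMF.map_comp]
  ext o
  rw [PMF.map_apply, PMF.map_apply]
  refine tsum_congr fun T => ?_
  by_cases hT : T ∈ (M.tree z).support
  · have h : ∀ x, T.numQueries x ≤ ℓ := hM z T hT
    simp only [Function.comp, dif_pos h, DecisionTree.toLocalView]
    by_cases ho : o = T.eval x <;> simp [ho]
  · rw [PMF.mem_support_iff, not_not] at hT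
    simp [hT]

/-- The mean of a real-valued function under a distribution on a finite type. -/
noncomputable def finMean {I : Type*} [Fintype I] (P : PMF I) (g : I → ℝ) : ℝ :=
  ∑ i, (P i).toReal * g i

section finMean

variable {I : Type*} [Fintype I] (P : PMF I)

lemma finMean_mono {g h : I → ℝ} (hgh : ∀ i, g i ≤ h i) : finMean P g ≤ finMean P h :=
  Finset.sum_le_sum fun i _ => mul_le_mul_of_nonneg_left (hgh i) ENNReal.toReal_nonneg

lemma finMean_const (c : ℝ) : finMean P (fun _ => c) = c := by
  have h : ∑ i, (P i).toReal = 1 := by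
    rw [← ENNReal.toReal_sum fun i _ => P.apply_ne_top i, ← tsum_fintype (L := .unconditional I),
      P.tsum_coe, ENNReal.toReal_one]
  rw [finMean, ← Finset.sum_mul, h, one_mul]

lemma finMean_add (g h : I → ℝ) :
    finMean P (fun i => g i + h i) = finMean P g + finMean P h := by
  simp only [finMean, mul_add, Finset.sum_add_distrib]

lemma finMean_sum {κ : Type*} (t : Finset κ) (g : κ → I → ℝ) :
    finMean P (fun i => ∑ k ∈ t, g k i) = ∑ k ∈ t, finMean P (g k) := by
  simp only [finMean, Finset.mul_sum]
  exact Finset.sum_comm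

lemma prob_map (f : I → WithBot Bool) (S : Set (WithBot Bool)) [∀ i, Decidable (f i ∈ S)] :
    prob (P.map f) S = finMean P fun i => if f i ∈ S then 1 else 0 := by
  rw [prob, PMF.toOuterMeasure_map_apply, PMF.toOuterMeasure_apply_fintype,
    ENNReal.toReal_sum]
  · refine Finset.sum_congr rfl fun i _ => ?_
    by_cases h : f i ∈ S <;> simp [h]
  · intro i _
    by_cases h : f i ∈ S <;> simp [h, P.apply_ne_top i]

end finMean

/-! ### Query degrees, kernels and bands. -/

variable [Fintype α]

/-- The probability that `i` is queried on some string. -/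
noncomputable def queryDegree (P : PMF (LocalView n α ℓ N)) (i : Fin n) : ℝ :=
  open Classical in finMean P fun F => if ∃ x, i ∈ F.queried x then 1 else 0

/-- The coordinates of degree at least `t`. -/
noncomputable def kernel (P : PMF (LocalView n α ℓ N)) (t : ℝ) : Finset (Fin n) :=
  open Classical in Finset.univ.filter fun i => t ≤ queryDegree P i

lemma mem_kernel {P : PMF (LocalView n α ℓ N)} {t : ℝ} {i : Fin n} :
    i ∈ kernel P t ↔ t ≤ queryDegree P i := by
  simp [kernel]

/-- Markov's inequality for degrees: a view touches at most `N` coordinates over all strings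
together, so the degrees sum to at most `N`. -/
lemma card_kernel_mul_le (P : PMF (LocalView n α ℓ N)) (t : ℝ) :
    (kernel P t).card * t ≤ N := by
  classical
  have h : ∑ i ∈ kernel P t, queryDegree P i ≤ N := by
    unfold queryDegree
    rw [← finMean_sum, ← finMean_const P (N : ℝ)]
    refine finMean_mono P fun F => ?_
    rw [Finset.sum_boole, Nat.cast_le]
    exact F.card_le_of_forall _ fun i hi => (Finset.mem_filter.1 hi).2
  refine le_trans ?_ h
  rw [← nsmul_eq_mul]
  exact Finset.card_nsmul_le_sum _ _ _ fun i hi => mem_kernel.1 hi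

/-- The coordinates whose degree lies in `[r ^ (-(j + 1)), r ^ (-j))`. -/
noncomputable def band (P : PMF (LocalView n α ℓ N)) (r : ℝ) (j : ℕ) : Finset (Fin n) :=
  kernel P ((r ^ (j + 1))⁻¹) \ kernel P ((r ^ j)⁻¹)

lemma queryDegree_le_of_notMem {P : PMF (LocalView n α ℓ N)} {r : ℝ} {j : ℕ} {i : Fin n}
    (hK : i ∉ kernel P ((r ^ j)⁻¹)) (hB : i ∉ band P r j) :
    queryDegree P i ≤ (r ^ (j + 1))⁻¹ := by
  by_contra h
  exact hB (Finset.mem_sdiff.2 ⟨mem_kernel.2 (not_le.1 h).le, hK⟩)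

lemma disjoint_band (P : PMF (LocalView n α ℓ N)) {r : ℝ} (hr : 1 ≤ r) {j k : ℕ} (hjk : j < k) :
    Disjoint (band P r j) (band P r k) := by
  rw [Finset.disjoint_left]
  intro i hj hk
  refine (Finset.mem_sdiff.1 hk).2 (mem_kernel.2 ?_)
  refine le_trans ?_ (mem_kernel.1 (Finset.mem_sdiff.1 hj).1)
  have : 0 < r := by linarith
  have := pow_le_pow_right₀ hr (Nat.succ_le_of_lt hjk)
  gcongr

/-- Averaging over levels: the bands are disjoint, so the at most `ℓ` queries of a view on `x` meet
at most `ℓ` of them. -/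
lemma exists_band_rarely_queried (P : PMF (LocalView n α ℓ N)) {r : ℝ} (hr : 1 ≤ r) {J : ℕ}
    (hJ : 0 < J) (x : Fin n → α) :
    ∃ j < J, finMean P (fun F => if Disjoint (F.queried x) (band P r j) then 0 else 1) ≤
      ℓ / J := by
  by_contra! h
  have h1 : ∑ j ∈ Finset.range J,
      finMean P (fun F => if Disjoint (F.queried x) (band P r j) then 0 else 1) ≤ ℓ := by
    rw [← finMean_sum, ← finMean_const P (ℓ : ℝ)]
    refine finMean_mono P fun F => ?_
    have h2 : ∑ j ∈ Finset.range J, (F.queried x ∩ band P r j).card ≤ ℓ := by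
      rw [← Finset.card_biUnion]
      · refine (Finset.card_le_card ?_).trans (F.card_queried_le x)
        exact Finset.biUnion_subset.2 fun _ _ => Finset.inter_subset_left
      · intro j _ k _ hjk
        refine Disjoint.mono Finset.inter_subset_right Finset.inter_subset_right ?_
        rcases lt_or_gt_of_ne hjk with hjk | hjk
        · exact disjoint_band P hr hjk
        · exact (disjoint_band P hr hjk).symm
    refine le_trans ?_ (Nat.cast_le.2 h2)
    rw [Nat.cast_sum]
    refine Finset.sum_le_sum fun j _ => ?_
    split_ifs with hd
    · positivity
    · rw [Finset.disjoint_iff_inter_eq_empty, ← ne_eq, ← Finset.nonempty_iff_ne_empty] at hd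
      exact_mod_cast hd.card_pos
  have h3 : ∑ j ∈ Finset.range J, (ℓ : ℝ) / J <
      ∑ j ∈ Finset.range J,
        finMean P (fun F => if Disjoint (F.queried x) (band P r j) then 0 else 1) :=
    Finset.sum_lt_sum_of_nonempty (Finset.nonempty_range_iff.2 hJ.ne')
      fun j hj => h j (Finset.mem_range.1 hj)
  rw [Finset.sum_const, Finset.card_range, nsmul_eq_mul,
    mul_div_cancel₀ _ (by exact_mod_cast hJ.ne')] at h3
  linarith

/-! ### The petal estimator and its concentration. -/

/-- The unbiased estimator, from the sample `Q`, of the probability that on the string `x` no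
coordinate of `B` is queried and the output is `v`. It only reads `x` on `K` and `Q`. -/
noncomputable def petalStat (P : PMF (LocalView n α ℓ N)) (p : ℝ) (K B : Finset (Fin n)) (v : Bool)
    (x : Fin n → α) (Q : Finset (Fin n)) : ℝ :=
  finMean P fun F =>
    if F.out x = v ∧ Disjoint (F.queried x) B ∧ F.queried x \ K ⊆ Q then
      (p ^ (F.queried x \ K).card)⁻¹ else 0

/-- A view contributes only if all its queries lie in `K ∪ Q`, where the strings agree; its run is
then the same on both. This is what lets the sampler evaluate the estimator after guessing `K`. -/
lemma petalStat_congr (P : PMF (LocalView n α ℓ N)) (p : ℝ) {K : Finset (Fin n)}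
    (B : Finset (Fin n)) (v : Bool) {x y : Fin n → α} {Q : Finset (Fin n)}
    (h : ∀ i ∈ K ∪ Q, x i = y i) : petalStat P p K B v x Q = petalStat P p K B v y Q := by
  have key (F : LocalView n α ℓ N) (x y : Fin n → α) (h : ∀ i ∈ K ∪ Q, x i = y i)
      (hx : F.queried x \ K ⊆ Q) : F.queried y = F.queried x ∧ F.out y = F.out x :=
    F.congr x y fun i hi => h i <| by
      by_cases hK : i ∈ K
      · exact Finset.mem_union_left _ hK
      · exact Finset.mem_union_right _ (hx (Finset.mem_sdiff.2 ⟨hi, hK⟩))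
  unfold petalStat
  congr 1
  funext F
  by_cases hx : F.queried x \ K ⊆ Q
  · rw [(key F x y h hx).1, (key F x y h hx).2]
  · by_cases hy : F.queried y \ K ⊆ Q
    · rw [(key F y x (fun i hi => (h i hi).symm) hy).1,
        (key F y x (fun i hi => (h i hi).symm) hy).2]
    · simp [hx, hy]

/-- The weight cancels the probability that the petal is sampled. -/
lemma bernoulliMean_petalStat (P : PMF (LocalView n α ℓ N)) {p : ℝ} (hp : 0 < p)
    (K B : Finset (Fin n)) (v : Bool) (x : Fin n → α) :
    bernoulliMean p Finset.univ (petalStat P p K B v x) =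
      finMean P fun F => if F.out x = v ∧ Disjoint (F.queried x) B then 1 else 0 := by
  have h : petalStat P p K B v x = fun Q => ∑ F, ((P F).toReal *
      (if F.out x = v ∧ Disjoint (F.queried x) B then (p ^ (F.queried x \ K).card)⁻¹ else 0)) *
        (if F.queried x \ K ⊆ Q then 1 else 0) := by
    funext Q
    refine Finset.sum_congr rfl fun F _ => ?_
    by_cases h1 : F.out x = v <;> by_cases h2 : Disjoint (F.queried x) B <;>
      by_cases h3 : F.queried x \ K ⊆ Q <;> simp [h1, h2, h3]
  rw [h, bernoulliMean_sum]
  refine Finset.sum_congr rfl fun F _ => ?_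
  rw [bernoulliMean_const_mul, bernoulliMean_indicator_subset p (Finset.subset_univ _), mul_assoc]
  congr 1
  beta_reduce
  split_ifs with hF
  · exact inv_mul_cancel₀ (pow_pos hp _).ne'
  · rw [zero_mul]

/-- The probability that `i` belongs to the petal of a query set that avoids `B`. -/
noncomputable def petalInfluence (P : PMF (LocalView n α ℓ N)) (K B : Finset (Fin n))
    (x : Fin n → α) (i : Fin n) : ℝ :=
  finMean P fun F => if i ∈ F.queried x \ K ∧ Disjoint (F.queried x) B then 1 else 0

/-- Only views with `i` in their petal can change their contribution, and each weight is at most `p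
^ (-ℓ)`. -/
lemma abs_petalStat_insert_sub_le (P : PMF (LocalView n α ℓ N)) {p : ℝ} (hp : 0 < p) (hp1 : p ≤ 1)
    (K B : Finset (Fin n)) (v : Bool) (x : Fin n → α) (i : Fin n) (Q : Finset (Fin n)) :
    |petalStat P p K B v x (insert i Q) - petalStat P p K B v x Q| ≤
      (p ^ ℓ)⁻¹ * petalInfluence P K B x i := by
  unfold petalStat petalInfluence finMean
  rw [← Finset.sum_sub_distrib, Finset.mul_sum]
  refine (Finset.abs_sum_le_sum_abs _ _).trans (Finset.sum_le_sum fun F _ => ?_)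
  rw [← mul_sub, abs_mul, abs_of_nonneg ENNReal.toReal_nonneg, mul_left_comm]
  refine mul_le_mul_of_nonneg_left ?_ ENNReal.toReal_nonneg
  have hpow : (p ^ (F.queried x \ K).card)⁻¹ ≤ (p ^ ℓ)⁻¹ := by
    have := pow_le_pow_of_le_one hp.le hp1
      ((Finset.card_le_card Finset.sdiff_subset).trans (F.card_queried_le x) :
        (F.queried x \ K).card ≤ ℓ)
    gcongr
  have hpos : 0 ≤ (p ^ (F.queried x \ K).card)⁻¹ := by positivity
  by_cases hB : Disjoint (F.queried x) B
  swap
  · simp [hB]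
  by_cases hi : i ∈ F.queried x \ K
  · simp only [hi, hB, true_and, and_self, if_true, mul_one]
    split_ifs <;> simp only [sub_self, sub_zero, zero_sub, abs_neg, abs_zero, abs_of_nonneg hpos] <;>
      first | exact hpow | positivity
  · simp [Finset.subset_insert_iff_of_notMem hi, hi]

/-- Maximum times sum. Coordinates of `K` lie in no petal and those of `B` are excluded by
disjointness, so every influence is at most `θ`; petals have at most `ℓ` elements, so the influences
sum to at most `ℓ`. -/
lemma sum_petalInfluence_sq_le (P : PMF (LocalView n α ℓ N)) {K B : Finset (Fin n)}
    (x : Fin n → α) {θ : ℝ} (hθ : 0 ≤ θ) (hdeg : ∀ i, i ∉ K → i ∉ B → queryDegree P i ≤ θ) :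
    ∑ i, petalInfluence P K B x i ^ 2 ≤ θ * ℓ := by
  have h0 (i : Fin n) : 0 ≤ petalInfluence P K B x i := by
    rw [← finMean_const P (0 : ℝ)]
    exact finMean_mono P fun F => by split_ifs <;> norm_num
  have hle (i : Fin n) : petalInfluence P K B x i ≤ θ := by
    by_cases hiK : i ∈ K
    · rw [← finMean_const P θ]
      exact finMean_mono P fun F => by simp [hiK, hθ]
    by_cases hiB : i ∈ B
    · rw [← finMean_const P θ]
      refine finMean_mono P fun F => ?_
      rw [if_neg]
      · exact hθ
      · rintro ⟨h1, h2⟩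
        exact Finset.disjoint_left.1 h2 (Finset.mem_sdiff.1 h1).1 hiB
    · refine le_trans (finMean_mono P fun F => ?_) (hdeg i hiK hiB)
      by_cases h : i ∈ F.queried x
      · have hx : ∃ x, i ∈ F.queried x := ⟨x, h⟩
        simp only [hx, if_true]
        split_ifs <;> norm_num
      · rw [if_neg fun h' => h (Finset.mem_sdiff.1 h'.1).1]
        split_ifs <;> norm_num
  have hsum : ∑ i, petalInfluence P K B x i ≤ ℓ := by
    unfold petalInfluence
    rw [← finMean_sum, ← finMean_const P (ℓ : ℝ)]
    refine finMean_mono P fun F => ?_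
    rw [Finset.sum_boole, Nat.cast_le]
    refine (Finset.card_le_card fun i hi => ?_).trans (F.card_queried_le x)
    exact (Finset.mem_sdiff.1 (Finset.mem_filter.1 hi).2.1).1
  calc ∑ i, petalInfluence P K B x i ^ 2 ≤ ∑ i, θ * petalInfluence P K B x i :=
        Finset.sum_le_sum fun i _ => by
          rw [sq]; exact mul_le_mul_of_nonneg_right (hle i) (h0 i)
    _ = θ * ∑ i, petalInfluence P K B x i := by rw [Finset.mul_sum]
    _ ≤ θ * ℓ := mul_le_mul_of_nonneg_left hsum hθ

lemma sum_petalStat_difference_sq_le (P : PMF (LocalView n α ℓ N)) (p : ℝ) {K B : Finset (Fin n)}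
    (x : Fin n → α) {θ : ℝ} (hθ : 0 ≤ θ) (hdeg : ∀ i, i ∉ K → i ∉ B → queryDegree P i ≤ θ) :
    ∑ i, ((p ^ ℓ)⁻¹ * petalInfluence P K B x i) ^ 2 ≤ ((p ^ ℓ)⁻¹) ^ 2 * (θ * ℓ) := by
  simp only [mul_pow _ (petalInfluence P K B x _)]
  rw [← Finset.mul_sum]
  exact mul_le_mul_of_nonneg_left (sum_petalInfluence_sq_le P x hθ hdeg) (by positivity)

open Classical in
-- Discarding views that meet `B` only lowers the mean, so no bound on the discarded mass is needed
-- here.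
lemma petalStat_upper_tail (P : PMF (LocalView n α ℓ N)) {p : ℝ} (hp : 0 < p) (hp1 : p ≤ 1)
    (hℓ : 0 < ℓ) {K B : Finset (Fin n)} (v : Bool) (x : Fin n → α) {θ m ε : ℝ} (hθ : 0 < θ)
    (hdeg : ∀ i, i ∉ K → i ∉ B → queryDegree P i ≤ θ) (hε : 0 ≤ ε)
    (hm : (finMean P fun F => if F.out x = v then 1 else 0) ≤ m) :
    bernoulliMean p Finset.univ (fun Q => if m + ε ≤ petalStat P p K B v x Q then 1 else 0) ≤
      Real.exp (-(ε ^ 2 / (2 * (((p ^ ℓ)⁻¹) ^ 2 * (θ * ℓ))))) := by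
  refine bernoulliMean_tail_le hp.le hp1 (fun i => (p ^ ℓ)⁻¹ * petalInfluence P K B x i) _ _
    (fun i _ Q _ => abs_petalStat_insert_sub_le P hp hp1 K B v x i Q) ?_ hε (by positivity)
    (sum_petalStat_difference_sq_le P p x hθ.le hdeg)
  rw [bernoulliMean_petalStat P hp]
  refine (finMean_mono P fun F => ?_).trans hm
  by_cases h1 : F.out x = v <;> by_cases h2 : Disjoint (F.queried x) B <;> simp [h1, h2]

open Classical in
-- Discarding views that meet `B` lowers the mean by at most `β`; apply the bounded differences
-- inequality to the negated estimator.
lemma petalStat_lower_tail (P : PMF (LocalView n α ℓ N)) {p : ℝ} (hp : 0 < p) (hp1 : p ≤ 1)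
    (hℓ : 0 < ℓ) {K B : Finset (Fin n)} (v : Bool) (x : Fin n → α) {θ m β ε : ℝ} (hθ : 0 < θ)
    (hdeg : ∀ i, i ∉ K → i ∉ B → queryDegree P i ≤ θ) (hε : 0 ≤ ε)
    (hβ : (finMean P fun F => if Disjoint (F.queried x) B then 0 else 1) ≤ β)
    (hm : m + β ≤ finMean P fun F => if F.out x = v then 1 else 0) :
    bernoulliMean p Finset.univ (fun Q => if petalStat P p K B v x Q < m - ε then 1 else 0) ≤
      Real.exp (-(ε ^ 2 / (2 * (((p ^ ℓ)⁻¹) ^ 2 * (θ * ℓ))))) := by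
  have hmean : bernoulliMean p Finset.univ (fun Q => -petalStat P p K B v x Q) ≤ -m := by
    have h1 := bernoulliMean_const_mul p Finset.univ (-1) (petalStat P p K B v x)
    simp only [neg_one_mul] at h1
    rw [h1, bernoulliMean_petalStat P hp, neg_le_neg_iff]
    have h2 : (finMean P fun F => if F.out x = v then 1 else 0) ≤
        finMean P fun F => (if F.out x = v ∧ Disjoint (F.queried x) B then 1 else 0) +
          (if Disjoint (F.queried x) B then 0 else 1) := by
      refine finMean_mono P fun F => ?_
      by_cases h1 : F.out x = v <;> by_cases h2 : Disjoint (F.queried x) B <;> simp [h1, h2]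
    rw [finMean_add] at h2
    linarith
  refine le_trans (bernoulliMean_mono hp.le hp1 fun Q _ => ?_)
    (bernoulliMean_tail_le hp.le hp1 (fun i => (p ^ ℓ)⁻¹ * petalInfluence P K B x i) _ _
    (fun i _ Q _ => ?_) hmean hε (by positivity)
    (sum_petalStat_difference_sq_le P p x hθ.le hdeg))
  · by_cases h : petalStat P p K B v x Q < m - ε
    · rw [if_pos h, if_pos (by linarith)]
    · rw [if_neg h]
      split_ifs <;> norm_num
  · rw [neg_sub_neg, abs_sub_comm]
    exact abs_petalStat_insert_sub_le P hp hp1 K B v x i Q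

end LocalView

/-! ### The sample-based algorithm and its error. -/

section Sampler

variable {n : ℕ} {α : Type v} {ℓ N : ℕ}

lemma prob_pure (o : WithBot Bool) (S : Set (WithBot Bool)) [Decidable (o ∈ S)] :
    prob (PMF.pure o) S = if o ∈ S then 1 else 0 := by
  rw [prob, PMF.toOuterMeasure_pure_apply]
  by_cases h : o ∈ S <;> simp [h]

lemma SampleAlgorithm.prob_run {Z : Type u} (A : SampleAlgorithm Z n α) (z : Z) (x : Fin n → α)
    (S : Set (WithBot Bool)) :
    prob (A.run z x) S = bernoulliMean A.p Finset.univ fun Q =>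
      prob (A.output z Q (restriction x (if Q.card ≤ A.cap then Q else ∅))) S := by
  have hne (R : PMF (WithBot Bool)) : R.toOuterMeasure S ≠ ⊤ := by
    refine ne_top_of_le_ne_top ENNReal.one_ne_top ?_
    exact (R.toOuterMeasure.mono (Set.subset_univ S)).trans_eq
      ((PMF.toOuterMeasure_apply_eq_one_iff R _).2 (Set.subset_univ _))
  rw [prob, SampleAlgorithm.run, PMF.toOuterMeasure_bind_apply, tsum_fintype,
    ENNReal.toReal_sum fun Q _ => ENNReal.mul_ne_top (PMF.apply_ne_top _ _) (hne _),
    bernoulliMean, Finset.powerset_univ]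
  refine Finset.sum_congr rfl fun Q _ => ?_
  rw [ENNReal.toReal_mul, bernoulliSubset, PMF.ofFintype_apply, ENNReal.coe_toReal, prob,
    Finset.card_univ, Fintype.card_fin, NNReal.coe_mul, NNReal.coe_pow, NNReal.coe_pow,
    NNReal.coe_sub A.p_le_one, NNReal.coe_one]

/-- The union bound over kernel guesses. Both the kernel size bound and the tail exponent scale with
`r ^ j`, and the exponent has a further factor `r` from the band gap, so the single condition `H`
serves all levels. -/
lemma pow_mul_exp_neg_le {p r : ℝ} (hp : 0 < p) (hr : 1 ≤ r) (hℓ : 0 < ℓ) {J : ℕ} (hJ : 0 < J)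
    {a : ℕ} (H : 2 * ℓ * (N * a + 12 * J) ≤ (1 / 8) ^ 2 * (p ^ ℓ) ^ 2 * r) {j k : ℕ}
    (hk : (k : ℝ) * (r ^ j)⁻¹ ≤ N) :
    (a : ℝ) ^ k *
        Real.exp (-((1 / 8) ^ 2 / (2 * (((p ^ ℓ)⁻¹) ^ 2 * ((r ^ (j + 1))⁻¹ * ℓ))))) ≤
      1 / (12 * J) := by
  have hr0 : 0 < r := by linarith
  have hℓ' : (0 : ℝ) < ℓ := by exact_mod_cast hℓ
  have hJ' : (0 : ℝ) < J := by exact_mod_cast hJ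
  have hrj : 1 ≤ r ^ j := one_le_pow₀ hr
  set E := (1 / 8 : ℝ) ^ 2 / (2 * (((p ^ ℓ)⁻¹) ^ 2 * ((r ^ (j + 1))⁻¹ * ℓ))) with hE
  have hE' : E = (1 / 8) ^ 2 * (p ^ ℓ) ^ 2 * r * r ^ j / (2 * ℓ) := by
    rw [hE, pow_succ]
    field_simp
    ring
  have hk' : (k : ℝ) ≤ N * r ^ j := by
    rwa [← div_eq_mul_inv, div_le_iff₀ (by positivity)] at hk
  have hEle : (k : ℝ) * a + 12 * J ≤ E := by
    rw [hE', le_div_iff₀ (by positivity)]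
    calc ((k : ℝ) * a + 12 * J) * (2 * ℓ) ≤ (N * r ^ j * a + 12 * J * r ^ j) * (2 * ℓ) := by
          have : (12 * J : ℝ) ≤ 12 * J * r ^ j := le_mul_of_one_le_right (by positivity) hrj
          gcongr
      _ = 2 * ℓ * (N * a + 12 * J) * r ^ j := by ring
      _ ≤ _ := by gcongr
  -- The crude `a ≤ exp a` replaces `log a` by `a`.
  have hpow : (a : ℝ) ^ k ≤ Real.exp (k * a) := by
    rw [Real.exp_nat_mul]
    gcongr
    linarith [Real.add_one_le_exp (a : ℝ)]
  calc (a : ℝ) ^ k * Real.exp (-E) ≤ Real.exp (k * a) * Real.exp (-E) := by gcongr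
    _ = Real.exp (k * a - E) := by rw [← Real.exp_add, sub_eq_add_neg]
    _ ≤ Real.exp (-(12 * J)) := Real.exp_le_exp.2 (by linarith)
    _ ≤ 1 / (12 * J) := by
      rw [Real.exp_neg, ← one_div]
      gcongr
      linarith [Real.add_one_le_exp (12 * J : ℝ)]

variable [Fintype α]

/-- The sampled symbols `y` (on the set `Q`) support the output `v`: at one of the first `J`
levels, some assignment to the kernel makes the estimator large. -/
def Supports (P : PMF (LocalView n α ℓ N)) (p r : ℝ) (J : ℕ) (v : Bool) (Q : Finset (Fin n))
    (y : Fin n → Option α) : Prop :=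
  ∃ j < J, ∃ w : Fin n → α, (∀ i ∈ Q, y i = some (w i)) ∧
    11 / 24 ≤ petalStat P p (kernel P (r ^ j)⁻¹) (band P r j) v w Q

open Classical in
-- Union bound over levels and kernel assignments; each candidate string is fixed before `Q` is
-- drawn, so the upper tail applies to it.
lemma bernoulliMean_supports_le (P : PMF (LocalView n α ℓ N)) {p r : ℝ} (hp : 0 < p)
    (hp1 : p ≤ 1) (hr : 1 ≤ r) (hℓ : 0 < ℓ) {J : ℕ} (hJ : 0 < J)
    (H : 2 * ℓ * (N * Fintype.card α + 12 * J) ≤ (1 / 8) ^ 2 * (p ^ ℓ) ^ 2 * r)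
    (v : Bool) (x : Fin n → α)
    (hx : ∀ j < J, ∀ w : Fin n → α, (∀ i ∉ kernel P (r ^ j)⁻¹, w i = x i) →
      (finMean P fun F => if F.out w = v then 1 else 0) ≤ 1 / 3) :
    bernoulliMean p Finset.univ
      (fun Q => if Supports P p r J v Q (restriction x Q) then 1 else 0) ≤ 1 / 12 := by
  have hr0 : 0 < r := by linarith
  have hJ' : (0 : ℝ) < J := by exact_mod_cast hJ
  let overwrite (K : Finset (Fin n)) (κ : K → α) : Fin n → α :=
    fun i => if h : i ∈ K then κ ⟨i, h⟩ else x i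
  have hpt : ∀ Q ⊆ (Finset.univ : Finset (Fin n)),
      (if Supports P p r J v Q (restriction x Q) then (1 : ℝ) else 0) ≤
      ∑ j ∈ Finset.range J, ∑ κ : kernel P (r ^ j)⁻¹ → α,
        if 1 / 3 + 1 / 8 ≤ petalStat P p (kernel P (r ^ j)⁻¹) (band P r j) v
          (overwrite (kernel P (r ^ j)⁻¹) κ) Q then 1 else 0 := by
    intro Q _
    have hnn (j : ℕ) (κ : kernel P (r ^ j)⁻¹ → α) : (0 : ℝ) ≤
        if 1 / 3 + 1 / 8 ≤ petalStat P p (kernel P (r ^ j)⁻¹) (band P r j) v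
          (overwrite (kernel P (r ^ j)⁻¹) κ) Q then 1 else 0 := by split_ifs <;> norm_num
    split_ifs with hs
    · obtain ⟨j, hj, w, hw, hstat⟩ := hs
      refine le_trans ?_ (Finset.single_le_sum
        (fun k _ => Finset.sum_nonneg fun κ _ => hnn k κ) (Finset.mem_range.2 hj))
      refine le_trans ?_ (Finset.single_le_sum (fun κ _ => hnn j κ)
        -- Only the kernel part of `w` matters: on the rest of `Q` it agrees with `x`.
        (Finset.mem_univ fun i : kernel P (r ^ j)⁻¹ => w i))
      rw [if_pos]
      rw [← petalStat_congr P p (band P r j) v (x := w)]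
      · linarith
      · intro i hi
        by_cases hK : i ∈ kernel P (r ^ j)⁻¹
        · simp [overwrite, hK]
        · have hQ := (Finset.mem_union.1 hi).resolve_left hK
          have := hw i hQ
          simp only [restriction, hQ, if_true, Option.some.injEq] at this
          simp [overwrite, hK, this]
    · exact Finset.sum_nonneg fun k _ => Finset.sum_nonneg fun κ _ => hnn k κ
  refine (bernoulliMean_mono hp.le hp1 hpt).trans ?_
  rw [bernoulliMean_sum]
  have hlevel : ∀ j ∈ Finset.range J, bernoulliMean p Finset.univ (fun Q =>
      ∑ κ : kernel P (r ^ j)⁻¹ → α,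
        if 1 / 3 + 1 / 8 ≤ petalStat P p (kernel P (r ^ j)⁻¹) (band P r j) v
          (overwrite (kernel P (r ^ j)⁻¹) κ) Q then (1 : ℝ) else 0) ≤ 1 / (12 * J) := by
    intro j hj
    rw [bernoulliMean_sum]
    refine le_trans (Finset.sum_le_sum fun κ _ =>
      petalStat_upper_tail P hp hp1 hℓ v (overwrite (kernel P (r ^ j)⁻¹) κ)
        (θ := (r ^ (j + 1))⁻¹) (by positivity)
        (fun i hK hB => queryDegree_le_of_notMem hK hB) (by norm_num)
        (hx j (Finset.mem_range.1 hj) _ fun i hi => by simp [overwrite, hi])) ?_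
    rw [Finset.sum_const, nsmul_eq_mul, Finset.card_univ, Fintype.card_fun, Fintype.card_coe,
      Nat.cast_pow]
    exact pow_mul_exp_neg_le hp hr hℓ hJ H (card_kernel_mul_le P _)
  refine (Finset.sum_le_sum hlevel).trans_eq ?_
  rw [Finset.sum_const, Finset.card_range, nsmul_eq_mul]
  field_simp

open Classical in
-- At a level whose band is rarely queried on `x`, the string `x` itself is a witness with high
-- probability.
lemma bernoulliMean_not_supports_le (P : PMF (LocalView n α ℓ N)) {p r : ℝ} (hp : 0 < p)
    (hp1 : p ≤ 1) (hr : 1 ≤ r) (hℓ : 0 < ℓ) {J : ℕ} (hJ : 12 * ℓ ≤ J)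
    (H : 2 * ℓ * (N * Fintype.card α + 12 * J) ≤ (1 / 8) ^ 2 * (p ^ ℓ) ^ 2 * r)
    (v : Bool) (x : Fin n → α)
    (hx : 2 / 3 ≤ finMean P fun F => if F.out x = v then 1 else 0) :
    bernoulliMean p Finset.univ
      (fun Q => if Supports P p r J v Q (restriction x Q) then 0 else 1) ≤ 1 / 12 := by
  have hr0 : 0 < r := by linarith
  have hJ0 : 0 < J := by omega
  have hJ1 : (1 : ℝ) ≤ J := by exact_mod_cast hJ0
  have hJ' : 12 * (ℓ : ℝ) ≤ J := by exact_mod_cast hJ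
  obtain ⟨j, hj, hband⟩ := exists_band_rarely_queried P hr hJ0 x
  have hband' := hband.trans (show (ℓ : ℝ) / J ≤ 1 / 12 by
    rw [div_le_div_iff₀ (by positivity) (by norm_num)]; linarith)
  -- Here 7/12 = 2/3 - 1/12, and 7/12 - 1/8 is the threshold 11/24.
  have h1 := petalStat_lower_tail P hp hp1 hℓ (K := kernel P (r ^ j)⁻¹) v x (m := 7 / 12)
    (ε := 1 / 8) (θ := (r ^ (j + 1))⁻¹) (by positivity)
    (fun i hK hB => queryDegree_le_of_notMem hK hB) (by norm_num) hband' (by linarith)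
  -- One fixed string needs no union bound, hence `k := 0`.
  have h2 := pow_mul_exp_neg_le hp hr hℓ hJ0 H (j := j) (k := 0) (by simp)
  rw [pow_zero, one_mul] at h2
  refine le_trans (bernoulliMean_mono hp.le hp1 fun Q _ => ?_) ((h1.trans h2).trans ?_)
  · by_cases hs : Supports P p r J v Q (restriction x Q)
    · rw [if_pos hs]
      split_ifs <;> norm_num
    · rw [if_neg hs, if_pos]
      by_contra hstat
      exact hs ⟨j, hj, x, fun i hi => by simp [restriction, hi], by linarith⟩
  · gcongr
    linarith

open Classical in
/-- The sample-based algorithm that outputs `v` if the sample supports `v` but not the other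
value, and `⊥` otherwise. -/
noncomputable def sampler {Z : Type u} (P : Z → PMF (LocalView n α ℓ N)) (p : ℝ≥0) (hp1 : p ≤ 1)
    (r : ℝ) (J cap : ℕ) : SampleAlgorithm Z n α where
  p := p
  p_le_one := hp1
  cap := cap
  output z Q y := PMF.pure <|
    if Supports (P z) p r J true Q y ∧ ¬Supports (P z) p r J false Q y then (true : Bool)
    else if Supports (P z) p r J false Q y ∧ ¬Supports (P z) p r J true Q y then (false : Bool)
    else ⊥

open Classical in
/-- The failure modes of the sampler: too large a sample, support for the wrong value, no support
for the right value. -/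
lemma le_prob_sampler_run {Z : Type u} (P : Z → PMF (LocalView n α ℓ N)) {p : ℝ≥0} (hp1 : p ≤ 1)
    (r : ℝ) (J cap : ℕ) (z : Z) (x : Fin n → α) (b : Bool) {γ δ : ℝ}
    (hcap : bernoulliMean (p : ℝ) (Finset.univ : Finset (Fin n))
      (fun Q => if cap < Q.card then 1 else 0) ≤ γ)
    (hwrong : bernoulliMean (p : ℝ) Finset.univ
      (fun Q => if Supports (P z) p r J (!b) Q (restriction x Q) then 1 else 0) ≤ δ) :
    1 - (γ + δ) ≤ prob ((sampler P p hp1 r J cap).run z x) {(b : WithBot Bool), ⊥} ∧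
    1 - (γ + δ) - bernoulliMean (p : ℝ) Finset.univ
      (fun Q => if Supports (P z) p r J b Q (restriction x Q) then 0 else 1) ≤
        prob ((sampler P p hp1 r J cap).run z x) {(b : WithBot Bool)} := by
  have hp1' : (p : ℝ) ≤ 1 := by exact_mod_cast hp1
  rw [SampleAlgorithm.prob_run, SampleAlgorithm.prob_run]
  have hpt (Q : Finset (Fin n)) (hQ : ¬cap < Q.card) :
      (if Q.card ≤ cap then Q else ∅) = Q := if_pos (not_lt.1 hQ)
  have hmean {g a c : Finset (Fin n) → ℝ} (h : ∀ Q, 1 ≤ g Q + (a Q + c Q)) :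
      1 - (bernoulliMean p Finset.univ a + bernoulliMean p Finset.univ c) ≤
        bernoulliMean p Finset.univ g := by
    have := bernoulliMean_mono (s := Finset.univ) p.coe_nonneg hp1'
      (g := fun _ => 1) (h := fun Q => g Q + (a Q + c Q)) fun Q _ => h Q
    rw [bernoulliMean_one, bernoulliMean_add, bernoulliMean_add] at this
    linarith
  have hnn (R : PMF (WithBot Bool)) (S : Set (WithBot Bool)) : 0 ≤ prob R S :=
    ENNReal.toReal_nonneg
  constructor
  · have := hmean (g := fun Q => prob ((sampler P p hp1 r J cap).output z Q
        (restriction x (if Q.card ≤ cap then Q else ∅))) {(b : WithBot Bool), ⊥})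
      (a := fun Q => if cap < Q.card then 1 else 0)
      (c := fun Q => if Supports (P z) p r J (!b) Q (restriction x Q) then 1 else 0) fun Q => by
        by_cases hQ : cap < Q.card
        · rw [if_pos hQ]
          refine le_add_of_nonneg_of_le (hnn _ _) (le_add_of_nonneg_right ?_)
          split_ifs <;> norm_num
        · simp only [sampler, hpt Q hQ, prob_pure, if_neg hQ]
          cases b <;> by_cases ht : Supports (P z) p r J true Q (restriction x Q) <;>
            by_cases hf : Supports (P z) p r J false Q (restriction x Q) <;> simp [ht, hf]
    refine le_trans ?_ this
    linarith
  · have := hmean (g := fun Q => prob ((sampler P p hp1 r J cap).output z Q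
        (restriction x (if Q.card ≤ cap then Q else ∅))) {(b : WithBot Bool)})
      (a := fun Q => if cap < Q.card then 1 else 0)
      (c := fun Q => (if Supports (P z) p r J (!b) Q (restriction x Q) then 1 else 0) +
        if Supports (P z) p r J b Q (restriction x Q) then 0 else 1) fun Q => by
        by_cases hQ : cap < Q.card
        · rw [if_pos hQ]
          refine le_add_of_nonneg_of_le (hnn _ _) (le_add_of_nonneg_right ?_)
          split_ifs <;> norm_num
        · simp only [sampler, hpt Q hQ, prob_pure, if_neg hQ]
          cases b <;> by_cases ht : Supports (P z) p r J true Q (restriction x Q) <;>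
            by_cases hf : Supports (P z) p r J false Q (restriction x Q) <;> simp [ht, hf]
    rw [bernoulliMean_add] at this
    refine le_trans ?_ this
    linarith

theorem relaxedComputes_sampler {Z : Type u} [DecidableEq α] {f : Z × (Fin n → α) →. Bool}
    {V : Set (Fin n → α)} {M : QueryAlgorithm Z n α} (hM : M.QueryComplexityAtMost ℓ)
    (hℓ : 0 < ℓ) (hcomp : RelaxedComputes M.run f V (1 / 3)) {ρ₀ ρ₁ : ℝ}
    (hrob : RelaxedRobust M.run f ρ₀ ρ₁ (1 / 3)) {p : ℝ≥0} (hp : 0 < p) (hp1 : p ≤ 1) {r : ℝ}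
    (hr : 1 ≤ r) {cap : ℕ} {t : ℝ} (ht : 0 < t) (htcap : t ≤ cap + 1) (hpt : 12 * (p * n) ≤ t)
    (H : 2 * ℓ * (((Fintype.card α + 1) ^ ℓ : ℕ) * Fintype.card α + 12 * (12 * ℓ : ℕ)) ≤
      (1 / 8) ^ 2 * ((p : ℝ) ^ ℓ) ^ 2 * r)
    (hK₀ : ((Fintype.card α + 1) ^ ℓ : ℕ) * r ^ (12 * ℓ) ≤ ρ₀ * n)
    (hK₁ : ((Fintype.card α + 1) ^ ℓ : ℕ) * r ^ (12 * ℓ) ≤ ρ₁ * n) :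
    RelaxedComputes (sampler (M.view ℓ) p hp1 r (12 * ℓ) cap).run f V (1 / 3) := by
  classical
  intro z x b hb
  have hp' : (0 : ℝ) < p := by exact_mod_cast hp
  have hp1' : (p : ℝ) ≤ 1 := by exact_mod_cast hp1
  have hr0 : 0 < r := by linarith
  set P := M.view ℓ z with hP
  have hcap : bernoulliMean (p : ℝ) (Finset.univ : Finset (Fin n))
      (fun Q => if cap < Q.card then 1 else 0) ≤ 1 / 12 := by
    refine (bernoulliMean_lt_card_le hp'.le hp1' _ ht htcap).trans ?_
    rw [Finset.card_univ, Fintype.card_fin, div_le_iff₀ ht]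
    linarith
  -- Every kernel fits in the robustness radius, so overwriting it leaves the wrong value with
  -- probability at most 1/3.
  have hfar : ∀ j < 12 * ℓ, ∀ w : Fin n → α, (∀ i ∉ kernel P (r ^ j)⁻¹, w i = x i) →
      (finMean P fun F => if F.out w = ((!b : Bool) : WithBot Bool) then 1 else 0) ≤ 1 / 3 := by
    intro j hj w hw
    have hdist : hammingDist x w ≤ (kernel P (r ^ j)⁻¹).card := by
      refine Finset.card_le_card fun i hi => ?_
      by_contra hK
      exact (Finset.mem_filter.1 hi).2 (hw i hK).symm
    have hcard : ((kernel P (r ^ j)⁻¹).card : ℝ) ≤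
        ((Fintype.card α + 1) ^ ℓ : ℕ) * r ^ (12 * ℓ) := by
      have h := card_kernel_mul_le P (r ^ j)⁻¹
      rw [← div_eq_mul_inv, div_le_iff₀ (by positivity)] at h
      have := pow_le_pow_right₀ hr hj.le
      exact h.trans (by gcongr)
    have h := hrob z x b hb w <| ((Nat.cast_le (α := ℝ)).2 hdist).trans <| hcard.trans <| by
      cases b
      · simpa using hK₀
      · simpa using hK₁
    rw [QueryAlgorithm.run_eq_map_view hM, prob_map, ← hP] at h
    have h1 : (finMean P fun F => (if F.out w ∈ ({(b : WithBot Bool), ⊥} : Set _) then 1 else 0) +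
        if F.out w = ((!b : Bool) : WithBot Bool) then 1 else 0) ≤ 1 := by
      refine le_of_le_of_eq (finMean_mono P fun F => ?_) (finMean_const P 1)
      by_cases ho : F.out w = ((!b : Bool) : WithBot Bool)
      · rw [ho]; cases b <;> simp
      · rw [if_neg ho]
        split_ifs <;> norm_num
    rw [finMean_add] at h1
    linarith
  have hwrong := bernoulliMean_supports_le P hp' hp1' hr hℓ (J := 12 * ℓ) (by omega) H (!b) x hfar
  obtain ⟨h1, h2⟩ := le_prob_sampler_run (M.view ℓ) hp1 r (12 * ℓ) cap z x b hcap hwrong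
  refine ⟨fun hx => ?_, fun _ => by linarith⟩
  have hright := (hcomp z x b hb).1 hx
  rw [QueryAlgorithm.run_eq_map_view hM, prob_map, ← hP] at hright
  have h3 := bernoulliMean_not_supports_le P hp' hp1' hr hℓ le_rfl H b x (by
    refine le_trans (by norm_num) (hright.trans (finMean_mono P fun F => ?_))
    simp only [Set.mem_singleton_iff, le_refl])
  -- Three failures of probability at most 1/12 each stay below 1/3.
  linarith

end Sampler

/-! ### Choice of parameters. -/

lemma exists_forall_le_rpow {e : ℝ} (he : 0 < e) (B : ℝ) :
    ∃ n₀ : ℕ, ∀ n : ℕ, n₀ ≤ n → B ≤ (n : ℝ) ^ e :=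
  Filter.eventually_atTop.1
    (((tendsto_rpow_atTop he).comp tendsto_natCast_atTop_atTop).eventually_ge_atTop B)

lemma log_add_one_pow_lower_bounds {ℓ : ℕ} (hℓ : 1 ≤ ℓ) :
    (12 / 25 : ℝ) ≤ Real.log (ℓ + 1) ^ 2 ∧ (8 / 25 : ℝ) ≤ Real.log (ℓ + 1) ^ 3 := by
  have h1 : Real.log 2 ≤ Real.log (ℓ + 1) := by
    have : (1 : ℝ) ≤ ℓ := by exact_mod_cast hℓ
    exact Real.log_le_log (by norm_num) (by linarith)
  have h2 : (0.693 : ℝ) ≤ Real.log (ℓ + 1) := by linarith [Real.log_two_gt_d9]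
  constructor
  · calc (12 / 25 : ℝ) ≤ 0.693 ^ 2 := by norm_num
      _ ≤ _ := by gcongr
  · calc (8 / 25 : ℝ) ≤ 0.693 ^ 3 := by norm_num
      _ ≤ _ := by gcongr

lemma card_add_one_pow_le {n ℓ : ℕ} {a s : ℝ} (hn : 1 ≤ (n : ℝ)) (hs : 0 ≤ s)
    (ha0 : 0 ≤ a) (ha : a ≤ (n : ℝ) ^ s) : (a + 1) ^ ℓ ≤ 2 ^ ℓ * (n : ℝ) ^ (s * ℓ) := by
  have h1 : 1 ≤ (n : ℝ) ^ s := Real.one_le_rpow hn hs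
  rw [Real.rpow_mul_natCast (by positivity), ← mul_pow]
  gcongr
  linarith

end RobustLocal

theorem theorem7p3 :
    ∃ C : ℝ, 0 < C ∧ ∃ c : ℝ, 0 < c ∧
      ∀ ℓ : ℕ, 1 ≤ ℓ → ∀ ρ₀ ρ₁ : ℝ, 0 < ρ₀ → 0 < ρ₁ →
        ∃ n₀ : ℕ, ∀ n : ℕ, n₀ ≤ n →
          ∀ (Z : Type u) (α : Type v) [Fintype α] [DecidableEq α],
            (Fintype.card α : ℝ) ≤
              (n : ℝ) ^ (c / ((ℓ : ℝ) ^ 3 * Real.log ((ℓ : ℝ) + 1) ^ 3)) →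
            ∀ (f : Z × (Fin n → α) →. Bool) (V : Set (Fin n → α))
              (M : RobustLocal.QueryAlgorithm Z n α),
              M.QueryComplexityAtMost ℓ →
              RobustLocal.RelaxedComputes M.run f V (1 / 3) →
              RobustLocal.RelaxedRobust M.run f ρ₀ ρ₁ (1 / 3) →
              ∃ N : RobustLocal.SampleAlgorithm Z n α,
                N.SampleComplexityAtMost
                  ((n : ℝ) ^ (1 - 1 / (C * ((ℓ : ℝ) ^ 2 * Real.log ((ℓ : ℝ) + 1) ^ 2)))) ∧
                RobustLocal.RelaxedComputes N.run f V (1 / 3) := by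
  -- The argument saves a factor `n ^ s` with `s = 1 / (192 ℓ ^ 2)`, free of logarithms. The
  -- constants absorb the lower bounds on the logarithms: 400 · 12/25 = 192 and 1000 · 8/25 ≥ 192.
  refine ⟨400, by norm_num, 1 / 1000, by norm_num, fun ℓ hℓ ρ₀ ρ₁ hρ₀ hρ₁ => ?_⟩
  have hL : (1 : ℝ) ≤ ℓ := by exact_mod_cast hℓ
  have hL0 : (0 : ℝ) < ℓ := by linarith
  obtain ⟨hlog2, hlog3⟩ := RobustLocal.log_add_one_pow_lower_bounds hℓ
  set s : ℝ := 1 / (192 * ℓ ^ 2) with hs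
  have hs0 : 0 < s := by positivity
  -- The three thresholds absorb, in turn, the constants depending on `ℓ` in `H`, the kernel size
  -- against the robustness radius, and the factor 12 in Markov's inequality.
  obtain ⟨n₁, hn₁⟩ := RobustLocal.exists_forall_le_rpow
    (show (0 : ℝ) < 1 / (96 * ℓ) by positivity) (128 * ℓ * (2 ^ ℓ + 144 * ℓ))
  obtain ⟨n₂, hn₂⟩ := RobustLocal.exists_forall_le_rpow
    (show (0 : ℝ) < 1 / 4 by norm_num) (2 ^ ℓ / min ρ₀ ρ₁)
  obtain ⟨n₃, hn₃⟩ := RobustLocal.exists_forall_le_rpow hs0 12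
  refine ⟨max 1 (max n₁ (max n₂ n₃)), fun n hn Z α _ _ hα f V M hM hcomp hrob => ?_⟩
  simp only [max_le_iff] at hn
  obtain ⟨hn0, hn1, hn2, hn3⟩ := hn
  specialize hn₁ n hn1
  specialize hn₂ n hn2
  specialize hn₃ n hn3
  have hn : (1 : ℝ) ≤ n := by exact_mod_cast hn0
  have hnpos : (0 : ℝ) < n := by linarith
  have hcard : (Fintype.card α : ℝ) ≤ (n : ℝ) ^ s := by
    refine hα.trans (Real.rpow_le_rpow_of_exponent_le hn ?_)
    rw [hs, div_le_div_iff₀ (by positivity) (by positivity)]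
    have h1 : (ℓ : ℝ) ^ 2 ≤ ℓ ^ 3 := pow_le_pow_right₀ hL (by norm_num)
    have h2 : (ℓ : ℝ) ^ 2 * (8 / 25) ≤ ℓ ^ 3 * Real.log (ℓ + 1) ^ 3 := by gcongr
    linarith [sq_nonneg (ℓ : ℝ)]
  have hexp : 1 / (400 * ((ℓ : ℝ) ^ 2 * Real.log (ℓ + 1) ^ 2)) ≤ s := by
    rw [hs]
    apply one_div_le_one_div_of_le (by positivity)
    have := mul_le_mul_of_nonneg_left hlog2 (sq_nonneg (ℓ : ℝ))
    linarith
  set t : ℝ := (n : ℝ) ^ (1 - 1 / (400 * ((ℓ : ℝ) ^ 2 * Real.log ((ℓ : ℝ) + 1) ^ 2))) with ht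
  have ht0 : 0 < t := by positivity
  let p : ℝ≥0 := ⟨(n : ℝ) ^ (-(2 * s)), by positivity⟩
  have hpv : (p : ℝ) = (n : ℝ) ^ (-(2 * s)) := rfl
  have hp0 : 0 < p := by
    rw [← NNReal.coe_pos, hpv]; positivity
  have hp1 : p ≤ 1 := by
    rw [← NNReal.coe_le_coe, hpv, NNReal.coe_one]
    exact Real.rpow_le_one_of_one_le_of_nonpos hn (by linarith)
  have hpt : 12 * ((p : ℝ) * n) ≤ t := by
    calc 12 * ((p : ℝ) * n) ≤ (n : ℝ) ^ s * ((n : ℝ) ^ (-(2 * s)) * (n : ℝ) ^ (1 : ℝ)) := by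
          rw [hpv, Real.rpow_one]; gcongr
      _ = (n : ℝ) ^ (1 - s) := by
          rw [← Real.rpow_add hnpos, ← Real.rpow_add hnpos]; congr 1; ring
      _ ≤ t := Real.rpow_le_rpow_of_exponent_le hn (by linarith)
  -- All kernels then have size at most `N * r ^ (12ℓ) = N * n ^ (1/2)`. The factor `p ^ (2ℓ)` costs
  -- half of the exponent of `r`; the remaining `n ^ (1 / (48ℓ))` is split equally between the
  -- alphabet and the constants.
  set r : ℝ := (n : ℝ) ^ (1 / (24 * (ℓ : ℝ))) with hr
  have hr1 : 1 ≤ r := Real.one_le_rpow hn (by positivity)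
  have hpow := RobustLocal.card_add_one_pow_le (ℓ := ℓ) hn hs0.le (Nat.cast_nonneg _) hcard
  have hK : (((Fintype.card α + 1) ^ ℓ : ℕ) : ℝ) * r ^ (12 * ℓ) ≤ min ρ₀ ρ₁ * n := by
    have hρ : 0 < min ρ₀ ρ₁ := lt_min hρ₀ hρ₁
    have h1 : r ^ (12 * ℓ) = (n : ℝ) ^ (1 / 2 : ℝ) := by
      rw [hr, ← Real.rpow_mul_natCast hnpos.le]
      congr 1
      push_cast
      field_simp
      norm_num
    have h2 : s * ℓ ≤ 1 / 4 := by
      rw [hs, div_mul_eq_mul_div, div_le_div_iff₀ (by positivity) (by norm_num)]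
      nlinarith
    rw [div_le_iff₀ hρ] at hn₂
    push_cast
    calc ((Fintype.card α : ℝ) + 1) ^ ℓ * r ^ (12 * ℓ)
        ≤ 2 ^ ℓ * (n : ℝ) ^ (s * ℓ) * (n : ℝ) ^ (1 / 2 : ℝ) := by rw [h1]; gcongr
      _ ≤ (n : ℝ) ^ (1 / 4 : ℝ) * min ρ₀ ρ₁ * (n : ℝ) ^ (1 / 4 : ℝ) * (n : ℝ) ^ (1 / 2 : ℝ) := by
          gcongr
      _ = min ρ₀ ρ₁ * ((n : ℝ) ^ (1 / 4 : ℝ) * (n : ℝ) ^ (1 / 4 : ℝ) * (n : ℝ) ^ (1 / 2 : ℝ)) := by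
          ring
      _ = min ρ₀ ρ₁ * n := by
          rw [← Real.rpow_add hnpos, ← Real.rpow_add hnpos]
          norm_num
  have H : 2 * (ℓ : ℝ) * (((Fintype.card α + 1) ^ ℓ : ℕ) * Fintype.card α + 12 * (12 * ℓ : ℕ)) ≤
      (1 / 8) ^ 2 * ((p : ℝ) ^ ℓ) ^ 2 * r := by
    have h1 : ((p : ℝ) ^ ℓ) ^ 2 * r =
        (n : ℝ) ^ (1 / (96 * (ℓ : ℝ))) * (n : ℝ) ^ (1 / (96 * (ℓ : ℝ))) := by
      rw [hpv, hr, ← Real.rpow_mul_natCast hnpos.le, ← Real.rpow_mul_natCast hnpos.le,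
        ← Real.rpow_add hnpos, ← Real.rpow_add hnpos, hs]
      congr 1
      push_cast
      field_simp
      norm_num
    have h2 : s * ℓ + s ≤ 1 / (96 * ℓ) := by
      have : s * ℓ + s ≤ s * (2 * ℓ) := by nlinarith
      refine this.trans_eq ?_
      rw [hs]
      field_simp
      norm_num
    have h3 : ((Fintype.card α : ℝ) + 1) ^ ℓ * Fintype.card α ≤
        2 ^ ℓ * (n : ℝ) ^ (1 / (96 * (ℓ : ℝ))) := by
      calc _ ≤ 2 ^ ℓ * (n : ℝ) ^ (s * ℓ) * (n : ℝ) ^ s := by gcongr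
        _ = 2 ^ ℓ * (n : ℝ) ^ (s * ℓ + s) := by rw [mul_assoc, ← Real.rpow_add hnpos]
        _ ≤ _ := by gcongr
    have h4 : 1 ≤ (n : ℝ) ^ (1 / (96 * (ℓ : ℝ))) := Real.one_le_rpow hn (by positivity)
    rw [mul_assoc _ _ r, h1]
    push_cast
    set y := (n : ℝ) ^ (1 / (96 * (ℓ : ℝ)))
    calc 2 * (ℓ : ℝ) * (((Fintype.card α : ℝ) + 1) ^ ℓ * Fintype.card α + 12 * (12 * ℓ))
        ≤ 2 * ℓ * (2 ^ ℓ * y + 144 * ℓ * y) := by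
          have : (12 : ℝ) * (12 * ℓ) ≤ 144 * ℓ * y := by nlinarith
          gcongr
      _ = (1 / 8) ^ 2 * ((128 * ℓ * (2 ^ ℓ + 144 * ℓ)) * y) := by ring
      _ ≤ (1 / 8) ^ 2 * (y * y) := by gcongr
  refine ⟨RobustLocal.sampler (M.view ℓ) p hp1 r (12 * ℓ) ⌊t⌋₊, ⟨Nat.floor_le ht0.le, ?_⟩,
    RobustLocal.relaxedComputes_sampler hM hℓ hcomp hrob hp0 hp1 hr1 ht0 (Nat.lt_floor_add_one t).le
      hpt H (hK.trans ?_) (hK.trans ?_)⟩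
  · have : (0 : ℝ) ≤ (p : ℝ) * n := by positivity
    change (p : ℝ) * n ≤ t
    linarith
  · gcongr
    exact min_le_left _ _
  · gcongr
    exact min_le_right _ _
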